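/- For $n\in\mathbb{N}=\{0,1,2,\dots\}$ let $\mathrm{supp}(n)$ be the set of positions of the digit $1$ in the binary expansion of $n$ (so $\mathrm{supp}(0)=\emptyset$), let $B_k=\{2^k,2^k+1,\dots,2^{k+1}-1\}$ for $k\in\mathbb{N}$, and let $$A=\{n\in\mathbb{N}: B_k\setminus\mathrm{supp}(n)\neq\emptyset\text{ for every }k\in\mathbb{N}\}\subset\mathbb{Z}.$$ Let $M$ be the first-order structure $(\mathbb{Z},+,A)$ (with $A$ as a unary predicate) and let $G$ be the additive group of $M$, so that $G(M)=(\mathbb{Z},+)$. A subset $X$ of a group $H$ (written additively) is a *J-set* if for every finite set $F$ of sequences $f:\mathbb{N}\to H$ there are $m\geq 1$, indices $t(1)<\dots<t(m)$ in $\mathbb{N}$ and $a(1),\dots,a(m+1)\in H$ such that $a(1)+f(t(1))+\cdots+a(m)+f(t(m))+a(m+1)\in X$ for every $f\in F$. The set $X$ is *generic* if finitely many left translates of $X$ cover $H$, and *weakly generic* if $X\cup Y$ is generic for some non-generic $Y\subset H$. Let $S^{\mathrm{ext}}_G(M)$ be the space of ultrafilters of externally definable subsets of $\mathbb{Z}$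 (traces on $M$ of sets definable with parameters in elementary extensions of $M$), with the topology generated by the sets $\{p: X\in p\}$ and with the translation action of $\mathbb{Z}$. A *subflow* is a non-empty closed $\mathbb{Z}$-invariant subset. A type is *weakly generic* if it lies in the closure $\mathrm{WGen}_G(M)$ of the union of all minimal subflows of $S^{\mathrm{ext}}_G(M)$. **Proposition.** The set $A$ is a J-set of $G$ in $M$, but it is not weakly generic in $M$: there is no non-generic $Y\subset\mathbb{Z}$ such that $A\cup Y$ is generic, and $A$ belongs to no weakly generic type $p\in\mathrm{WGen}_G(M)$. -/

import Mathlib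

namespace JSetExample

open Set

/-! ### Subsets of a group: J-sets, generic sets, weakly generic sets (additive notation) -/

/-- `X` is a J-set of the (not necessarily commutative) additive group `G`: for every finite set
`F` of sequences in `G` there are `m ≥ 1`, indices `t(0) < ⋯ < t(m-1)` and elements
`a(0), …, a(m)` of `G` such that
`a(0) + f(t(0)) + a(1) + f(t(1)) + ⋯ + a(m-1) + f(t(m-1)) + a(m) ∈ X` for every `f ∈ F`. -/
def IsJSet {G : Type*} [AddGroup G] (X : Set G) : Prop :=
  ∀ F : Set (ℕ → G), F.Finite →
    ∃ m : ℕ, 1 ≤ m ∧ ∃ t : Fin m → ℕ, StrictMono t ∧ ∃ a : Fin (m + 1) → G,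
      ∀ f ∈ F,
        (List.ofFn fun i : Fin m => a i.castSucc + f (t i)).sum + a (Fin.last m) ∈ X

/-- `X` is generic: finitely many left translates of `X` cover the group. -/
def IsGeneric {G : Type*} [AddGroup G] (X : Set G) : Prop :=
  ∃ F : Set G, F.Finite ∧ ⋃ g ∈ F, (fun x => g + x) '' X = univ

/-- `X` is weakly generic: `X ∪ Y` is generic for some non-generic `Y`. -/
def IsWeaklyGeneric {G : Type*} [AddGroup G] (X : Set G) : Prop :=
  ∃ Y : Set G, ¬ IsGeneric Y ∧ IsGeneric (X ∪ Y)

/-! ### The set `A` -/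

/-- The support of `n`: the set of positions of the digit `1` in the binary expansion of `n`. -/
def supp (n : ℕ) : Set ℕ := {i | n.testBit i = true}

/-- The block `B_k = {2^k, 2^k + 1, …, 2^(k+1) - 1}`. -/
def block (k : ℕ) : Set ℕ := Set.Ico (2 ^ k) (2 ^ (k + 1))

/-- The natural numbers whose support contains no block `B_k`, as a set of integers. -/
def A : Set ℤ := {z | ∃ n : ℕ, z = n ∧ ∀ k : ℕ, (block k \ supp n).Nonempty}

/-! ### The first-order structure `M = (ℤ, +, A)` -/

/-- The function symbols: a single binary one. -/
inductive Func : ℕ → Type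
  | add : Func 2

/-- The relation symbols: a single unary one. -/
inductive Rel : ℕ → Type
  | pred : Rel 1

/-- The language with a binary function symbol and a unary predicate. -/
def Lang : FirstOrder.Language.{0, 0} := ⟨Func, Rel⟩

/-- The structure `M = (ℤ, +, A)`. -/
instance structM : Lang.Structure ℤ where
  funMap := fun {_} f => match f with
    | Func.add => fun v => v 0 + v 1
  RelMap := fun {_} r => match r with
    | Rel.pred => fun v => v 0 ∈ A

/-- `A` is definable in `M` without parameters. -/
theorem definable_A : (∅ : Set ℤ).Definable₁ Lang A := by
  refine ⟨FirstOrder.Language.Relations.formula₁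
    (((Lang.lhomWithConstants (∅ : Set ℤ)).onRelation (Rel.pred : Lang.Relations 1)))
    (FirstOrder.Language.Term.var 0), ?_⟩
  ext v
  simp only [mem_ofPred_eq, FirstOrder.Language.Formula.realize_rel₁, FirstOrder.Language.Term.realize_var]
  rfl

/-! ### Externally definable sets and types -/

/-- `X ⊆ ℤ` is externally definable in `M`: it is the trace on `M` of a subset of some elementary
extension `N` of `M` that is definable in `N` with parameters. (As the language and `M` are
countable, the extensions in the lowest universe give all such traces.) -/
def ExtDef (X : Set ℤ) : Prop :=
  ∃ (N : Type) (_ : Lang.Structure N) (e : FirstOrder.Language.ElementaryEmbedding Lang ℤ N) (Y : Set N),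
    (univ : Set N).Definable₁ Lang Y ∧ X = e ⁻¹' Y

/-- Sets definable in `M`, in particular `A`, are externally definable. -/
theorem extDef_A : ExtDef A :=
  ⟨ℤ, _, FirstOrder.Language.ElementaryEmbedding.refl Lang ℤ, A,
    Set.Definable.mono definable_A (empty_subset _), rfl⟩

theorem ExtDef.compl {X : Set ℤ} (h : ExtDef X) : ExtDef Xᶜ := by
  obtain ⟨N, _, e, Y, hY, rfl⟩ := h
  exact ⟨N, _, e, Yᶜ, Set.Definable.compl hY, rfl⟩

theorem ExtDef.translate {X : Set ℤ} (h : ExtDef X) (g : ℤ) :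
    ExtDef ((fun x => g + x) ⁻¹' X) := by
  obtain ⟨N, _, e, Y, ⟨φ, hφ⟩, rfl⟩ := h
  have key : ∀ x : ℤ, e (g + x) =
      FirstOrder.Language.Structure.funMap (L := Lang) (Func.add : Lang.Functions 2) ![e g, e x] := by
    intro x
    have := e.map_fun (Func.add : Lang.Functions 2) ![g, x]
    rw [show (e ∘ ![g, x] : Fin 2 → N) = ![e g, e x] by ext i; fin_cases i <;> rfl] at this
    exact this
  refine ⟨N, _, e,
    {y | FirstOrder.Language.Structure.funMap (L := Lang) (Func.add : Lang.Functions 2) ![e g, y] ∈ Y},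
    ⟨φ.subst fun _ => FirstOrder.Language.Functions.apply₂
      (((Lang.lhomWithConstants (univ : Set N)).onFunction (Func.add : Lang.Functions 2)))
      (FirstOrder.Language.Constants.term (Lang.con (⟨e g, mem_univ _⟩ : (univ : Set N))))
      (FirstOrder.Language.Term.var 0), ?_⟩, ?_⟩
  · ext v
    have h2 := fun w => Set.ext_iff.mp hφ w
    simp only [mem_ofPred_eq] at h2 ⊢
    simp only [FirstOrder.Language.Formula.Realize, FirstOrder.Language.BoundedFormula.realize_subst] at h2 ⊢
    rw [← h2]
    simp only [FirstOrder.Language.Term.realize_functions_apply₂]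
    exact Iff.rfl
  · ext x
    simp [key]

/-- The elements of `S^ext_G(M)`: the complete types of externally definable subsets of
`G(M) = ℤ`, that is, the ultrafilters of externally definable sets. -/
@[ext]
structure ExtType where
  sets : Set (Set ℤ)
  extDef : ∀ X ∈ sets, ExtDef X
  fip : ∀ s ⊆ sets, s.Finite → (⋂₀ s).Nonempty
  complete : ∀ X, ExtDef X → X ∈ sets ∨ Xᶜ ∈ sets

/-- The topology of `S^ext_G(M)`, with the basic open sets `[X] = {p | X ∈ p}`, where `X` is
externally definable. -/
instance : TopologicalSpace ExtType :=
  TopologicalSpace.generateFrom {U | ∃ X, ExtDef X ∧ U = {p : ExtType | X ∈ p.sets}}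

/-- The action of `G(M) = ℤ` on `S^ext_G(M)`: `X ∈ g · p` if and only if `-g + X ∈ p`, where
`-g + X = {x | g + x ∈ X}`. -/
def ExtType.act (g : ℤ) (p : ExtType) : ExtType where
  sets := {X | ExtDef X ∧ (fun x => g + x) ⁻¹' X ∈ p.sets}
  extDef := fun _ h => h.1
  fip := by
    intro s hs hfin
    obtain ⟨x, hx⟩ := p.fip ((fun X => (fun x => g + x) ⁻¹' X) '' s)
      (by rintro _ ⟨X, hX, rfl⟩; exact (hs hX).2) (hfin.image _)
    exact ⟨g + x, fun X hX => hx _ ⟨X, hX, rfl⟩⟩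
  complete := fun X hX =>
    (p.complete _ (hX.translate g)).imp (fun h => ⟨hX, h⟩) (fun h => ⟨hX.compl, h⟩)

/-- `G(M)`-subflows of `S^ext_G(M)`: non-empty closed sets closed under the action of `G(M)`. -/
def IsSubflow (Y : Set ExtType) : Prop :=
  Y.Nonempty ∧ IsClosed Y ∧ ∀ (g : ℤ), ∀ p ∈ Y, p.act g ∈ Y

/-- `AP_G(M)`, the set of almost periodic types: the union of all minimal `G(M)`-subflows. -/
def AP : Set ExtType := ⋃₀ {Y | Minimal IsSubflow Y}

/-- `WGen_G(M)`, the set of weakly generic types: the closure of `AP_G(M)`. -/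
def WGen : Set ExtType := closure AP

end JSetExample

namespace JSetExample

open Set

/-! The block `B_k` has length `2 ^ k` and starts at position `2 ^ k`, so its digits form the number
`n / 2 ^ 2 ^ k % 2 ^ 2 ^ k`, and `A` forbids the maximal value.

J-set: for `K` sequences, pigeonhole modulo `P = 2 ^ 2 ^ K` gives common indices with all sums
divisible by `P`, hence zero on the blocks below `K`. From `B_K` on, a block has more values than
there are sums, so one shift, built block by block, keeps every sum off the all-ones pattern
(`exists_shift_mem_A`).

Not weakly generic: a long block of ones survives all small translations, so a finite union of
translates of `A` has syndetic complement. Thus if `A ∪ Y` is generic, so is `Y`; and by compactness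
every minimal subflow avoids `[A]`, as does the closure of their union because `[A]` is open. -/

theorem block_diff_supp_nonempty_iff (k n : ℕ) :
    (block k \ supp n).Nonempty ↔ n / 2 ^ 2 ^ k % 2 ^ 2 ^ k ≠ 2 ^ 2 ^ k - 1 := by
  rw [← not_iff_not, not_not, Set.not_nonempty_iff_eq_empty, Set.sdiff_eq_empty]
  constructor
  · intro h
    refine Nat.eq_of_testBit_eq fun j => ?_
    rw [Nat.testBit_mod_two_pow, Nat.testBit_div_two_pow, Nat.testBit_two_pow_sub_one]
    by_cases hj : j < 2 ^ k
    · have : n.testBit (j + 2 ^ k) = true :=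
        h (show j + 2 ^ k ∈ Set.Ico (2 ^ k) (2 ^ (k + 1)) from ⟨by omega, by rw [pow_succ]; omega⟩)
      simp [hj, this]
    · simp [hj]
  · rintro h i ⟨h₁, h₂⟩
    rw [pow_succ] at h₂
    obtain ⟨j, rfl⟩ := Nat.exists_eq_add_of_le' h₁
    have hj : j < 2 ^ k := by omega
    have := congrArg (fun x => x.testBit j) h
    simp only [Nat.testBit_mod_two_pow, Nat.testBit_div_two_pow,
      Nat.testBit_two_pow_sub_one] at this
    show n.testBit (j + 2 ^ k) = true
    simpa [hj] using this

theorem natCast_mem_A_iff (n : ℕ) :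
    (n : ℤ) ∈ A ↔ ∀ k, n / 2 ^ 2 ^ k % 2 ^ 2 ^ k ≠ 2 ^ 2 ^ k - 1 := by
  simp only [← block_diff_supp_nonempty_iff]
  constructor
  · rintro ⟨m, hm, h⟩
    rwa [Nat.cast_injective hm]
  · exact fun h => ⟨n, rfl, h⟩

theorem two_pow_two_pow_succ (k : ℕ) : 2 ^ 2 ^ (k + 1) = 2 ^ 2 ^ k * 2 ^ 2 ^ k := by
  rw [pow_succ, mul_two, pow_add]

theorem two_pow_two_pow_dvd {k l : ℕ} (h : k ≤ l) : 2 ^ 2 ^ k ∣ 2 ^ 2 ^ l :=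
  pow_dvd_pow 2 (Nat.pow_le_pow_right two_pos h)

theorem two_le_two_pow_two_pow (k : ℕ) : 2 ≤ 2 ^ 2 ^ k := by
  simpa using Nat.pow_le_pow_right two_pos (Nat.one_le_two_pow (n := k))

/-- The digits in the block `B_k` do not depend on multiples of `2 ^ 2 ^ (k + 1)`. -/
theorem add_mul_div_mod_block {k l : ℕ} (h : k < l) (x b : ℕ) :
    (x + b * 2 ^ 2 ^ l) / 2 ^ 2 ^ k % 2 ^ 2 ^ k = x / 2 ^ 2 ^ k % 2 ^ 2 ^ k := by
  obtain ⟨c, hc⟩ := two_pow_two_pow_dvd (Nat.succ_le_of_lt h)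
  rw [hc, Nat.succ_eq_add_one, two_pow_two_pow_succ,
    show x + b * (2 ^ 2 ^ k * 2 ^ 2 ^ k * c) = x + (b * c * 2 ^ 2 ^ k) * 2 ^ 2 ^ k by ring,
    Nat.add_mul_div_right _ _ (by positivity), Nat.add_mul_mod_self_right]

/-- Fewer than `P` residues modulo `P` can all be shifted away from `-1` simultaneously. -/
theorem exists_shift_mod_ne {P : ℕ} (S : Finset ℕ) (hS : S.card < P) :
    ∃ b < P, ∀ s ∈ S, (s + b) % P ≠ P - 1 := by
  have : NeZero P := ⟨by omega⟩
  have hcard : (S.image fun s : ℕ => (-1 - s : ZMod P)).card < (Finset.univ : Finset (ZMod P)).card :=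
    Finset.card_image_le.trans_lt (by simpa [ZMod.card] using hS)
  obtain ⟨b, -, hb⟩ := Finset.exists_mem_notMem_of_card_lt_card hcard
  refine ⟨b.val, ZMod.val_lt b, fun s hs h => hb (Finset.mem_image.2 ⟨s, hs, ?_⟩)⟩
  have h' : ((s + b.val + 1 : ℕ) : ZMod P) = 0 := by
    rw [ZMod.natCast_eq_zero_iff, Nat.dvd_iff_mod_eq_zero, Nat.add_mod, h]
    rcases Nat.lt_or_ge 1 P with h1 | h1
    · rw [Nat.mod_eq_of_lt h1, Nat.sub_add_cancel h1.le, Nat.mod_self]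
    · have : P = 1 := by have := NeZero.pos P; omega
      subst this; simp
  push_cast [ZMod.natCast_zmod_val] at h'
  linear_combination -h'

/-- Adding `b * 2 ^ 2 ^ L` changes no block below `L`, so `b` can be chosen for `B_L` alone.
Divisibility starts the induction at `L = K` with shift `0`. -/
theorem exists_shift_lt (K : ℕ) (S : Finset ℕ) (hS : S.card < 2 ^ 2 ^ K)
    (hdvd : ∀ s ∈ S, 2 ^ 2 ^ K ∣ s) {L : ℕ} (hL : K ≤ L) :
    ∃ a < 2 ^ 2 ^ L, ∀ s ∈ S, ∀ k < L, (s + a) / 2 ^ 2 ^ k % 2 ^ 2 ^ k ≠ 2 ^ 2 ^ k - 1 := by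
  induction L, hL using Nat.le_induction with
  | base =>
    refine ⟨0, by positivity, fun s hs k hk => ?_⟩
    obtain ⟨c, rfl⟩ := hdvd s hs
    have := add_mul_div_mod_block hk 0 c
    rw [add_zero, mul_comm, ← zero_add (c * _), this]
    have := two_le_two_pow_two_pow k
    simp only [Nat.zero_div, Nat.zero_mod]
    omega
  | succ L hL ih =>
    obtain ⟨a, ha, h⟩ := ih
    have hS' : (S.image fun s => (s + a) / 2 ^ 2 ^ L).card < 2 ^ 2 ^ L :=
      Finset.card_image_le.trans_lt
        (hS.trans_le (Nat.le_of_dvd (by positivity) (two_pow_two_pow_dvd hL)))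
    obtain ⟨b, hb, hb'⟩ := exists_shift_mod_ne _ hS'
    refine ⟨a + b * 2 ^ 2 ^ L, ?_, fun s hs k hk => ?_⟩
    · rw [two_pow_two_pow_succ]
      nlinarith
    · rw [← add_assoc]
      rcases Nat.lt_succ_iff_lt_or_eq.1 hk with hk | rfl
      · rw [add_mul_div_mod_block hk]
        exact h s hs k hk
      · rw [Nat.add_mul_div_right _ _ (by positivity)]
        exact hb' _ (Finset.mem_image_of_mem _ hs)

theorem exists_shift_mem_A (K : ℕ) (S : Finset ℕ) (hS : S.card < 2 ^ 2 ^ K)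
    (hdvd : ∀ s ∈ S, 2 ^ 2 ^ K ∣ s) : ∃ a : ℕ, ∀ s ∈ S, ((s + a : ℕ) : ℤ) ∈ A := by
  -- Large enough that `s + a < 2 * 2 ^ 2 ^ L`: block `L` then holds at most a carry `1`, and higher
  -- blocks are zero. The `+ 1` gives `2 ^ 2 ^ L ≥ 4`, so that carry does not fill the block.
  set L := K + 1 + S.sup id with hLdef
  obtain ⟨a, ha, h⟩ := exists_shift_lt K S hS hdvd (L := L) (by omega)
  refine ⟨a, fun s hs => (natCast_mem_A_iff _).2 fun k => ?_⟩
  have hs' : s < 2 ^ 2 ^ L := by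
    have h1 : s ≤ S.sup id := Finset.le_sup (f := id) hs
    calc s ≤ L := by omega
      _ < 2 ^ L := Nat.lt_two_pow_self
      _ < 2 ^ 2 ^ L := Nat.lt_two_pow_self
  rcases lt_trichotomy k L with hk | rfl | hk
  · exact h s hs k hk
  · have h4 : 2 ^ 2 ^ 1 ≤ 2 ^ 2 ^ L :=
      Nat.le_of_dvd (by positivity) (two_pow_two_pow_dvd (by omega))
    have h2 : (s + a) / 2 ^ 2 ^ L < 2 := by
      rw [Nat.div_lt_iff_lt_mul (by positivity)]; omega
    norm_num at h4
    rw [Nat.mod_eq_of_lt (by omega)]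
    omega
  · have h1 : 2 ^ 2 ^ (L + 1) ≤ 2 ^ 2 ^ k :=
      Nat.le_of_dvd (by positivity) (two_pow_two_pow_dvd hk)
    rw [two_pow_two_pow_succ] at h1
    have h3 := two_le_two_pow_two_pow L
    rw [Nat.div_eq_of_lt (by nlinarith), Nat.zero_mod]
    have := two_le_two_pow_two_pow k
    omega

/-- For finitely many integer sequences there are sums along a common non-empty set of indices
that are all divisible by a given `P`. -/
theorem exists_strictMono_dvd_sum {F : Set (ℕ → ℤ)} (hF : F.Finite) (P : ℕ) [NeZero P] :
    ∃ t : Fin P → ℕ, StrictMono t ∧ ∀ f ∈ F, (P : ℤ) ∣ ∑ i, f (t i) := by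
  have := hF.to_subtype
  -- Infinitely many indices share one vector of residues; `P` equal residues sum to zero modulo
  -- `P`.
  obtain ⟨c, hc⟩ := Finite.exists_infinite_fiber
    fun (n : ℕ) (f : F) => ((f.1 n : ℤ) : ZMod P)
  obtain ⟨T, hT, hcard⟩ := (Set.infinite_coe_iff.1 hc).exists_subset_card_eq P
  refine ⟨T.orderEmbOfFin hcard, (T.orderEmbOfFin hcard).strictMono, fun f hf => ?_⟩
  have hval (i : Fin P) : ((f (T.orderEmbOfFin hcard i) : ℤ) : ZMod P) = c ⟨f, hf⟩ :=
    congrFun (hT (T.orderEmbOfFin_mem hcard i)) ⟨f, hf⟩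
  rw [← ZMod.intCast_zmod_eq_zero_iff_dvd, Int.cast_sum]
  simp [hval]

theorem isJSet_A : IsJSet A := by
  intro F hF
  set K := hF.toFinset.card
  set P : ℕ := 2 ^ 2 ^ K with hP
  have hKP : K < P := Nat.lt_two_pow_self.trans Nat.lt_two_pow_self
  have : NeZero P := ⟨by positivity⟩
  obtain ⟨t, ht, hdvd⟩ := exists_strictMono_dvd_sum hF P
  -- Translating by `P * M` makes all the sums nonnegative and keeps them divisible by `P`.
  set M : ℕ := ∑ f ∈ hF.toFinset, (∑ i, f (t i)).natAbs with hM
  have hnonneg (f) (hf : f ∈ F) : 0 ≤ (∑ i, f (t i)) + ((P * M : ℕ) : ℤ) := by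
    have h1 : (∑ i, f (t i)).natAbs ≤ M :=
      Finset.single_le_sum (f := fun f : ℕ → ℤ => (∑ i, f (t i)).natAbs)
        (fun _ _ => Nat.zero_le _) (hF.mem_toFinset.2 hf)
    have h2 : M ≤ P * M := Nat.le_mul_of_pos_left _ (NeZero.pos P)
    omega
  obtain ⟨a, ha⟩ := exists_shift_mem_A K
    (hF.toFinset.image fun f : ℕ → ℤ => ((∑ i, f (t i)) + ((P * M : ℕ) : ℤ)).toNat)
    (Finset.card_image_le.trans_lt hKP) (by
      simp only [Finset.mem_image, Set.Finite.mem_toFinset]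
      rintro _ ⟨f, hf, rfl⟩
      rw [← Int.natCast_dvd_natCast, Int.toNat_of_nonneg (hnonneg f hf), ← hP]
      exact dvd_add (hdvd f hf) (by push_cast; exact dvd_mul_right _ _))
  refine ⟨P, NeZero.pos P, t, ht, fun i => if i = Fin.last P then ((P * M : ℕ) : ℤ) + a else 0,
    fun f hf => ?_⟩
  have h := ha _ (Finset.mem_image_of_mem _ (hF.mem_toFinset.2 hf))
  rw [Nat.cast_add, Int.toNat_of_nonneg (hnonneg f hf)] at h
  simpa [List.sum_ofFn, Fin.castSucc_ne_last, add_assoc] using h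

/-- The complement of a finite union of translates of `A` is syndetic. -/
theorem exists_finite_forall_exists_notMem_A {F : Set ℤ} (hF : F.Finite) :
    ∃ E : Set ℤ, E.Finite ∧ ∀ x : ℤ, ∃ e ∈ E, ∀ g ∈ F, g + (e + x) ∉ A := by
  obtain ⟨N, hN⟩ : ∃ N : ℕ, ∀ g ∈ F, g.natAbs ≤ N :=
    ⟨hF.toFinset.sup Int.natAbs,
      fun g hg => Finset.le_sup (f := Int.natAbs) (hF.mem_toFinset.2 hg)⟩
  set k := 2 * N with hk
  set P : ℕ := 2 ^ 2 ^ k with hP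
  have hNP : 2 * N < P := Nat.lt_two_pow_self.trans Nat.lt_two_pow_self
  have hP2 : (0 : ℤ) < P * P := by positivity
  -- This `e` makes `e + x` congruent to `(P - 1) * P + N` modulo `P * P`: block `k` is all ones,
  -- and adding `g` keeps the lower part in `[0, 2 * N]`, so nothing is carried or borrowed.
  refine ⟨Set.Ico 0 (P * P), Set.finite_Ico _ _, fun x =>
    ⟨(P * P - P + N - x) % (P * P), ⟨Int.emod_nonneg _ hP2.ne', Int.emod_lt_of_pos _ hP2⟩, ?_⟩⟩
  intro g hg hmem
  obtain ⟨n, hn, -⟩ := id hmem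
  rw [hn] at hmem
  refine (natCast_mem_A_iff n).1 hmem k ?_
  rw [← hP]
  have hgN := hN g hg
  set q := ((P : ℤ) * P - P + N - x) / (P * P) with hq
  have hdiv := Int.emod_add_mul_ediv ((P : ℤ) * P - P + N - x) (P * P)
  rw [← hq] at hdiv
  have hn' : (n : ℤ) = (g + N) + P * ((P - 1) + P * (-q)) := by
    rw [← hn]; linear_combination hdiv
  have h1 : (n : ℤ) / P = (P - 1) + P * (-q) := by
    rw [hn', Int.add_mul_ediv_left _ _ (by omega), Int.ediv_eq_zero_of_lt (by omega) (by omega),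
      zero_add]
  have h2 : (n : ℤ) / P % P = P - 1 := by
    rw [h1, Int.add_mul_emod_self_left, Int.emod_eq_of_lt (by omega) (by omega)]
  zify [show 1 ≤ P by omega]
  exact h2

theorem not_isWeaklyGeneric_A : ¬ IsWeaklyGeneric A := by
  rintro ⟨Y, hY, F, hF, hcover⟩
  obtain ⟨E, hE, h⟩ := exists_finite_forall_exists_notMem_A (hF.image Neg.neg)
  refine hY ⟨Set.image2 (fun e g => -e + g) E F, hE.image2 _ hF, Set.eq_univ_of_forall fun x => ?_⟩
  obtain ⟨e, he, hx⟩ := h x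
  have hmem : e + x ∈ ⋃ g ∈ F, (fun x => g + x) '' (A ∪ Y) := hcover ▸ mem_univ _
  simp only [mem_iUnion, mem_image, exists_prop] at hmem
  obtain ⟨g, hg, y, hy, hgy⟩ := hmem
  have hyx : y = -g + (e + x) := by rw [← hgy]; ring
  refine mem_biUnion (mem_image2_of_mem he hg) ⟨y, hy.resolve_left ?_, by rw [hyx]; ring⟩
  rw [hyx]
  exact hx _ (mem_image_of_mem _ hg)

/-- The type of externally definable sets in an ultrafilter on `ℤ`. -/
def ExtType.ofUltrafilter (u : Ultrafilter ℤ) : ExtType where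
  sets := {X | ExtDef X ∧ X ∈ u}
  extDef := fun _ h => h.1
  fip := fun _ hs hfin =>
    u.nonempty_of_mem ((Filter.sInter_mem hfin).2 fun _ hX => (hs hX).2)
  complete := fun X hX =>
    (u.mem_or_compl_mem X).imp (fun h => ⟨hX, h⟩) (fun h => ⟨hX.compl, h⟩)

/-- Makes the type space a continuous image of the compact space of ultrafilters on `ℤ`. -/
theorem ExtType.ofUltrafilter_surjective : Function.Surjective ExtType.ofUltrafilter := by
  intro p
  have : (Filter.generate p.sets).NeBot := Filter.generate_neBot_iff.2 fun t ht hfin => p.fip t ht hfin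
  have hle : ∀ X ∈ p.sets, X ∈ Ultrafilter.of (Filter.generate p.sets) := fun X hX =>
    Ultrafilter.of_le _ (Filter.mem_generate_of_mem hX)
  refine ⟨_, ExtType.ext (Set.ext fun X => ⟨?_, fun h => ⟨p.extDef X h, hle X h⟩⟩)⟩
  rintro ⟨hX, hXu⟩
  exact (p.complete X hX).resolve_right fun h =>
    Ultrafilter.compl_notMem_iff.2 hXu (hle _ h)

theorem ExtType.isOpen_setOf_mem {X : Set ℤ} (hX : ExtDef X) :
    IsOpen {p : ExtType | X ∈ p.sets} :=
  TopologicalSpace.isOpen_generateFrom_of_mem ⟨X, hX, rfl⟩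

theorem ExtType.continuous_ofUltrafilter : Continuous ExtType.ofUltrafilter := by
  refine continuous_generateFrom_iff.2 ?_
  rintro _ ⟨X, hX, rfl⟩
  have : ExtType.ofUltrafilter ⁻¹' {p : ExtType | X ∈ p.sets} = {u | X ∈ u} := by
    ext u
    exact and_iff_right hX
  rw [this]
  exact ultrafilter_isOpen_basic X

instance : CompactSpace ExtType :=
  ExtType.ofUltrafilter_surjective.compactSpace ExtType.continuous_ofUltrafilter

theorem ExtType.mem_act_sets {p : ExtType} {g : ℤ} {X : Set ℤ} (hX : ExtDef X) :
    X ∈ (p.act g).sets ↔ (fun x => g + x) ⁻¹' X ∈ p.sets :=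
  and_iff_right hX

theorem ExtType.act_act (g h : ℤ) (p : ExtType) : (p.act h).act g = p.act (g + h) := by
  ext X
  constructor
  · rintro ⟨hX, -, h'⟩
    refine ⟨hX, ?_⟩
    simpa only [preimage_preimage, add_assoc] using h'
  · rintro ⟨hX, h'⟩
    refine ⟨hX, hX.translate g, ?_⟩
    simpa only [preimage_preimage, add_assoc] using h'

/-- The types of `Y` whose whole orbit avoids `[A]` form a subflow once there is one; minimality
then makes it all of `Y`. -/
theorem A_notMem_of_mem_AP {q : ExtType} (hq : q ∈ AP) : A ∉ q.sets := by
  obtain ⟨Y, hY, hqY⟩ := hq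
  obtain ⟨-, hclosed, hinv⟩ := hY.prop
  let T (g : ℤ) : Set ExtType := {p | A ∉ (p.act g).sets}
  have hT (g : ℤ) : IsClosed (T g) := by
    have : T g = {p : ExtType | (fun x => g + x) ⁻¹' A ∈ p.sets}ᶜ := by
      ext p
      exact not_congr (ExtType.mem_act_sets extDef_A)
    rw [this]
    exact (ExtType.isOpen_setOf_mem (extDef_A.translate g)).isClosed_compl
  have hne : (Y ∩ ⋂ g, T g).Nonempty := by
    refine hclosed.isCompact.inter_iInter_nonempty T hT fun F => ?_
    obtain ⟨E, hE, hEF⟩ := exists_finite_forall_exists_notMem_A F.finite_toSet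
    -- Otherwise each translate of `q` by `e ∈ E` meets some condition `g ∈ F`; a point realizing
    -- these finitely many conditions contradicts the choice of `E`.
    by_contra hempty
    have hex : ∀ e : ℤ, ∃ g ∈ F, (fun x => g + e + x) ⁻¹' A ∈ q.sets := by
      intro e
      by_contra! hno
      refine hempty ⟨q.act e, hinv e q hqY, mem_iInter₂.2 fun g hg => ?_⟩
      show A ∉ ((q.act e).act g).sets
      rw [ExtType.act_act, ExtType.mem_act_sets extDef_A]
      exact hno g hg
    choose γ hγF hγ using hex
    obtain ⟨x, hx⟩ := q.fip ((fun e => (fun x => γ e + e + x) ⁻¹' A) '' E)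
      (by rintro _ ⟨e, -, rfl⟩; exact hγ e) (hE.image _)
    obtain ⟨e, he, hxe⟩ := hEF x
    have : γ e + e + x ∈ A := hx _ (mem_image_of_mem _ he)
    exact hxe _ (hγF e) (by rwa [add_assoc] at this)
  have hsub : IsSubflow (Y ∩ ⋂ g, T g) := by
    refine ⟨hne, hclosed.inter (isClosed_iInter hT), fun g p hp => ⟨hinv g p hp.1, ?_⟩⟩
    refine mem_iInter.2 fun h => ?_
    show A ∉ ((p.act g).act h).sets
    rw [ExtType.act_act]
    exact mem_iInter.1 hp.2 (h + g)
  have hq0 := mem_iInter.1 (hY.le_of_le hsub inter_subset_left hqY).2 0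
  intro hA
  refine hq0 ((ExtType.mem_act_sets extDef_A).2 ?_)
  simpa using hA

theorem A_notMem_of_mem_WGen {p : ExtType} (hp : p ∈ WGen) : A ∉ p.sets := by
  intro hA
  obtain ⟨q, hAq, hq⟩ := mem_closure_iff.1 hp _ (ExtType.isOpen_setOf_mem extDef_A) hA
  exact A_notMem_of_mem_AP hq hAq

end JSetExample

theorem mainTheorem9 :
    JSetExample.IsJSet JSetExample.A ∧
      ¬ JSetExample.IsWeaklyGeneric JSetExample.A ∧
      ∀ p ∈ JSetExample.WGen, JSetExample.A ∉ p.sets :=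
  ⟨JSetExample.isJSet_A, JSetExample.not_isWeaklyGeneric_A,
    fun _ hp => JSetExample.A_notMem_of_mem_WGen hp⟩
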